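/- Let $R$ be a Cohen–Macaulay (Noetherian) local ring and let $I \neq 0$ be a strongly Cohen–Macaulay ideal of $R$: that is, for a finite generating sequence $x_1,\dots,x_n$ of $I$, every homology module $H_i(x_1,\dots,x_n;R)$, $i\ge 0$, of the Koszul complex of $x_1,\dots,x_n$ over $R$ is a Cohen–Macaulay $R$-module (this does not depend on the choice of the generating sequence; the zero module counts as Cohen–Macaulay). Then $R/\operatorname{Ann}_R(I)$ is a maximal Cohen–Macaulay $R$-module, i.e. it is a nonzero finitely generated $R$-module with $$\operatorname{depth}_R R/\operatorname{Ann}_R(I)=\dim R/\operatorname{Ann}_R(I)=\dim R .$$ -/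

import Mathlib

/-! ## Depth and Cohen–Macaulay modules over a local ring -/

/-- The depth of a module `M` over a local ring `R`: the supremum of the lengths of the `M`-regular
sequences contained in the maximal ideal. (`RingTheory.Sequence.IsRegular` includes the condition
`(x₁, …, x_r) M ≠ M`.) -/
noncomputable def localDepth (R : Type*) [CommRing R] [IsLocalRing R]
    (M : Type*) [AddCommGroup M] [Module R M] : ℕ∞ :=
  ⨆ rs : {rs : List R // (∀ r ∈ rs, r ∈ IsLocalRing.maximalIdeal R) ∧
    RingTheory.Sequence.IsRegular M rs}, (rs.1.length : ℕ∞)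

/-- A finitely generated module `M` over a local ring is Cohen–Macaulay if it is zero or
`depth M = dim M`. -/
def IsCMModule (R : Type*) [CommRing R] [IsLocalRing R]
    (M : Type*) [AddCommGroup M] [Module R M] : Prop :=
  Module.Finite R M ∧
    (Subsingleton M ∨ (localDepth R M : WithBot ℕ∞) = Module.supportDim R M)

/-- A maximal Cohen–Macaulay module: a Cohen–Macaulay module `M` with `dim M = dim R`.
In particular `M ≠ 0`, the dimension of the zero module being `⊥`. -/
def IsMaximalCMModule (R : Type*) [CommRing R] [IsLocalRing R]
    (M : Type*) [AddCommGroup M] [Module R M] : Prop :=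
  IsCMModule R M ∧ Module.supportDim R M = ringKrullDim R

/-! ## The Koszul complex of a finite sequence -/

section Koszul

variable {R : Type*} [CommRing R] {n : ℕ}

/-- The Koszul differential of `x₁, …, x_n` on the exterior algebra of `Rⁿ`: contraction with the
linear form `e_j ↦ x_j`. -/
noncomputable def koszulDiff (x : Fin n → R) :
    ExteriorAlgebra R (Fin n → R) →ₗ[R] ExteriorAlgebra R (Fin n → R) :=
  CliffordAlgebra.contractLeft (Fintype.linearCombination R x)

theorem koszulDiff_koszulDiff (x : Fin n → R) (w : ExteriorAlgebra R (Fin n → R)) :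
    koszulDiff x (koszulDiff x w) = 0 :=
  CliffordAlgebra.contractLeft_contractLeft _ _

theorem koszulDiff_ι_mul (x : Fin n → R) (v : Fin n → R) (w : ExteriorAlgebra R (Fin n → R)) :
    koszulDiff x (ExteriorAlgebra.ι R v * w) =
      (∑ j, v j * x j) • w - ExteriorAlgebra.ι R v * koszulDiff x w :=
  CliffordAlgebra.contractLeft_ι_mul _ _ _

/-- The differential vanishes in degree `0`. -/
theorem koszulDiff_zero_degree (x : Fin n → R) (w : ExteriorAlgebra R (Fin n → R))
    (hw : w ∈ ⋀[R]^0 (Fin n → R)) : koszulDiff x w = 0 := by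
  rw [ExteriorAlgebra.exteriorPower, pow_zero, Submodule.mem_one] at hw
  obtain ⟨r, rfl⟩ := hw
  exact CliffordAlgebra.contractLeft_algebraMap _ _ r

/-- The differential maps degree `i + 1` to degree `i`. -/
theorem koszulDiff_mem (x : Fin n → R) (i : ℕ) (w : ExteriorAlgebra R (Fin n → R))
    (hw : w ∈ ⋀[R]^(i + 1) (Fin n → R)) : koszulDiff x w ∈ ⋀[R]^i (Fin n → R) := by
  induction i generalizing w with
  | zero =>
    rw [ExteriorAlgebra.exteriorPower, zero_add, pow_one] at hw
    obtain ⟨v, rfl⟩ := hw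
    have h := koszulDiff_ι_mul x v 1
    rw [mul_one, koszulDiff_zero_degree x 1 (by simp [ExteriorAlgebra.exteriorPower]),
      mul_zero, sub_zero] at h
    rw [h]
    exact Submodule.smul_mem _ _ (by simp [ExteriorAlgebra.exteriorPower])
  | succ i ih =>
    rw [ExteriorAlgebra.exteriorPower, pow_succ'] at hw
    induction hw using Submodule.mul_induction_on' with
    | mem_mul_mem a ha b hb =>
      obtain ⟨v, rfl⟩ := ha
      rw [koszulDiff_ι_mul]
      refine Submodule.sub_mem _ (Submodule.smul_mem _ _ hb) ?_
      rw [ExteriorAlgebra.exteriorPower, pow_succ']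
      exact Submodule.mul_mem_mul ⟨v, rfl⟩ (ih b hb)
    | add a _ b _ ha hb => rw [map_add]; exact Submodule.add_mem _ ha hb

/-- The cycles of degree `i` of the Koszul complex `⋯ → ⋀^{i+1} Rⁿ → ⋀^i Rⁿ → ⋯ → ⋀^0 Rⁿ → 0`. -/
noncomputable def koszulCycles (x : Fin n → R) (i : ℕ) :
    Submodule R (ExteriorAlgebra R (Fin n → R)) :=
  ⋀[R]^i (Fin n → R) ⊓ LinearMap.ker (koszulDiff x)

/-- The boundaries of degree `i` of the Koszul complex. -/
noncomputable def koszulBoundaries (x : Fin n → R) (i : ℕ) :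
    Submodule R (ExteriorAlgebra R (Fin n → R)) :=
  (⋀[R]^(i + 1) (Fin n → R)).map (koszulDiff x)

theorem koszulBoundaries_le_koszulCycles (x : Fin n → R) (i : ℕ) :
    koszulBoundaries x i ≤ koszulCycles x i := by
  rintro _ ⟨w, hw, rfl⟩
  exact ⟨koszulDiff_mem x i w hw, koszulDiff_koszulDiff x w⟩

/-- The Koszul homology `H_i(x₁, …, x_n; R)`: cycles modulo boundaries. -/
abbrev KoszulHomology (x : Fin n → R) (i : ℕ) : Type _ :=
  koszulCycles x i ⧸ (koszulBoundaries x i).submoduleOf (koszulCycles x i)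

end Koszul

/-- An ideal `I` of a local ring is strongly Cohen–Macaulay if, for a finite generating sequence
`x₁, …, x_n` of `I`, all the Koszul homology modules `H_i(x₁, …, x_n; R)` are Cohen–Macaulay.
(Over a Cohen–Macaulay local ring this does not depend on the sequence; the definition asks for it
for some sequence.) -/
def IsStronglyCMIdeal {R : Type*} [CommRing R] [IsLocalRing R] (I : Ideal R) : Prop :=
  ∃ (n : ℕ) (x : Fin n → R), Ideal.span (Set.range x) = I ∧
    ∀ i : ℕ, IsCMModule R (KoszulHomology x i)

/-!
Let `d = dim R` and let `x` be a sequence of length `n` generating `I`. If `Ann I = 0`, then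
`R / Ann I = R` is Cohen–Macaulay of dimension `d` by assumption. Otherwise the differential
`⋀ⁿ Rⁿ → ⋀ⁿ⁻¹ Rⁿ` of the Koszul complex has kernel `Ann I`, so that `R / Ann I` is isomorphic to the
module `B_{n-1}` of boundaries. If all `H_i` with `i < n` have depth at least `d`, then so do all
cycles `Z_i` and boundaries `B_i`, by induction on `i` along the exact sequences
`0 → B_i → Z_i → H_i → 0` and `0 → Z_{i+1} → ⋀^{i+1} Rⁿ → B_i → 0`
(`depthAtLeast_koszulBoundaries`). Depth is handled through the vanishing of `Ext^i(k, -)`, which by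
the Rees theorem in Mathlib agrees with the definition by regular sequences.

As `H_i` is Cohen–Macaulay, it remains to see that its dimension is at least `d`. Since `R` is
Cohen–Macaulay and `Ann I ≠ 0`, the ideal `I` lies in an associated prime `q` of `R` which is
minimal with `dim R/q = d` (`exists_minimal_associatedPrime`). It is shown that `q` is in the
support of `H_i` for all `i ≤ n` (`mem_support_koszulHomology`): the Koszul complex is rigid at `q`,
meaning that vanishing of `H_i` at `q` forces vanishing of `H_{i+1}` at `q`
(`KoszulLocallyExact.succ_degree`), while `H_n = Ann I` does not vanish at `q`. Rigidity is proved by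
adding the elements of the sequence one at a time; where the general theory uses Nakayama's lemma,
nilpotency of the elements in `R_q` is enough, and localizations are replaced by multiplication with
elements outside `q`.
-/

/-! ### Depth and the vanishing of `Ext` -/

universe u

section Depth

open CategoryTheory Abelian RingTheory.Sequence IsLocalRing

/-- The module `M` has depth at least `n`, in the sense that `Ext^i(k, M) = 0` for `i < n`, where `k`
is the residue field. For nonzero finitely generated `M` over a Noetherian ring this says that
`localDepth R M` is at least `n` (`iff_exists_isRegular`); the zero module satisfies it for all
`n`, although its `localDepth` is the supremum of the empty set, namely `0`. -/
def DepthAtLeast (R : Type u) [CommRing R] [IsLocalRing R] (n : ℕ) (M : Type u) [AddCommGroup M]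
    [Module R M] : Prop :=
  ∀ i < n, Subsingleton (Ext (ModuleCat.of R (R ⧸ maximalIdeal R)) (ModuleCat.of R M) i)

namespace DepthAtLeast

variable {R : Type u} [CommRing R] [IsLocalRing R] {n : ℕ}
  {M M₁ M₂ M₃ : Type u} [AddCommGroup M] [Module R M] [AddCommGroup M₁] [Module R M₁]
  [AddCommGroup M₂] [Module R M₂] [AddCommGroup M₃] [Module R M₃]

theorem of_subsingleton [Subsingleton M] : DepthAtLeast R n M := fun i _ =>
  AddCommGrpCat.subsingleton_of_isZero <|
    (((extFunctorObj (ModuleCat.of R (R ⧸ maximalIdeal R)) i).map_isZero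
      (ModuleCat.isZero_of_subsingleton (ModuleCat.of R M))))

/-- In a short exact sequence `0 → M₁ → M₂ → M₃ → 0` one even has
`depth M₁ ≥ min (depth M₂) (depth M₃ + 1)`; the cruder bound suffices here. -/
theorem left_of_exact {f : M₁ →ₗ[R] M₂} {g : M₂ →ₗ[R] M₃} (hfg : Function.Exact f g)
    (hf : Function.Injective f) (hg : Function.Surjective g)
    (h₂ : DepthAtLeast R n M₂) (h₃ : DepthAtLeast R n M₃) : DepthAtLeast R n M₁ := by
  have hS := ModuleCat.shortComplex_shortExact
    (ModuleCat.shortComplexOfCompEqZero f g hfg.linearMap_comp_eq_zero) hfg hf hg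
  intro i hi
  refine ⟨fun a b => sub_eq_zero.mp ?_⟩
  have := h₂ i hi
  generalize a - b = c
  cases i with
  | zero =>
    have := hS.mono_f
    exact Ext.postcomp_mk₀_injective_of_mono _
      (ModuleCat.ofHom f) (@Subsingleton.elim _ (h₂ 0 hi) _ _)
  | succ i =>
    obtain ⟨e, rfl⟩ := Ext.covariant_sequence_exact₁ _ hS c (Subsingleton.elim _ _) rfl
    have := h₃ i (by omega)
    rw [Subsingleton.elim e 0, Ext.zero_comp]

theorem middle_of_exact {f : M₁ →ₗ[R] M₂} {g : M₂ →ₗ[R] M₃} (hfg : Function.Exact f g)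
    (hf : Function.Injective f) (hg : Function.Surjective g)
    (h₁ : DepthAtLeast R n M₁) (h₃ : DepthAtLeast R n M₃) : DepthAtLeast R n M₂ := by
  have hS := ModuleCat.shortComplex_shortExact
    (ModuleCat.shortComplexOfCompEqZero f g hfg.linearMap_comp_eq_zero) hfg hf hg
  intro i hi
  refine ⟨fun a b => sub_eq_zero.mp ?_⟩
  have := h₁ i hi
  have := h₃ i hi
  obtain ⟨e, he⟩ := Ext.covariant_sequence_exact₂ _ hS (a - b) (Subsingleton.elim _ _)
  rw [← he, Subsingleton.elim e 0, Ext.zero_comp]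

theorem of_linearEquiv (e : M₁ ≃ₗ[R] M₂) (h : DepthAtLeast R n M₁) : DepthAtLeast R n M₂ :=
  middle_of_exact (f := e.toLinearMap) (g := (0 : M₂ →ₗ[R] PUnit.{u + 1}))
    (fun y => ⟨fun _ => e.surjective y, fun _ => rfl⟩) e.injective
    (fun _ => ⟨0, Subsingleton.elim _ _⟩) h of_subsingleton

theorem pi_fin (h : DepthAtLeast R n M) : ∀ m : ℕ, DepthAtLeast R n (Fin m → M)
  | 0 => of_subsingleton
  | m + 1 => by
    refine middle_of_exact (f := LinearMap.single R (fun _ : Fin (m + 1) => M) 0)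
      (g := LinearMap.funLeft R M Fin.succ) (fun y => ⟨fun hy => ⟨y 0, ?_⟩, ?_⟩)
      (Pi.single_injective (M := fun _ : Fin (m + 1) => M) 0)
      (LinearMap.funLeft_surjective_of_injective _ _ _ (Fin.succ_injective m)) h (pi_fin h m)
    · ext i
      cases i using Fin.cases with
      | zero => simp
      | succ i => simpa using (congrFun hy i).symm
    · rintro ⟨x, rfl⟩
      ext i
      simp [LinearMap.funLeft_apply]

theorem of_free [Module.Free R M] [Module.Finite R M] (h : DepthAtLeast R n R) :
    DepthAtLeast R n M :=
  of_linearEquiv (Module.finBasis R M).equivFun.symm (pi_fin h _)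

theorem smul_top_lt_top [Nontrivial M] [Module.Finite R M] :
    maximalIdeal R • (⊤ : Submodule R M) < ⊤ :=
  (Submodule.top_ne_ideal_smul_of_le_jacobson_annihilator
    (IsLocalRing.maximalIdeal_le_jacobson _)).symm.lt_top

variable [IsNoetherianRing R]

/-- The Rees theorem for the maximal ideal. -/
theorem iff_exists_isRegular [Nontrivial M] [Module.Finite R M] :
    DepthAtLeast R n M ↔
      ∃ rs : List R, rs.length = n ∧ (∀ r ∈ rs, r ∈ maximalIdeal R) ∧ IsRegular M rs := by
  have hsupp : Module.support R (R ⧸ maximalIdeal R) =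
      PrimeSpectrum.zeroLocus (maximalIdeal R) := by
    rw [Module.support_eq_zeroLocus, Ideal.annihilator_quotient]
  constructor
  · exact ModuleCat.exists_isRegular_of_exists_subsingleton_ext (maximalIdeal R) n
      (ModuleCat.of R M) smul_top_lt_top (ModuleCat.of R (R ⧸ maximalIdeal R)) hsupp
  · rintro ⟨rs, rfl, hmem, hrs⟩
    exact ModuleCat.subsingleton_ext_of_exists_isRegular (maximalIdeal R)
      (ModuleCat.of R (R ⧸ maximalIdeal R)) hsupp.subset (ModuleCat.of R M) smul_top_lt_top
      rs hmem hrs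

theorem of_le_localDepth [Nontrivial M] [Module.Finite R M] (h : (n : ℕ∞) ≤ localDepth R M) :
    DepthAtLeast R n M := by
  intro i hi
  have hlt : (i : ℕ∞) < localDepth R M := lt_of_lt_of_le (by exact_mod_cast hi) h
  obtain ⟨⟨rs, hmem, hrs⟩, hi'⟩ := lt_iSup_iff.mp hlt
  exact iff_exists_isRegular.mpr ⟨rs, rfl, hmem, hrs⟩ i (by exact_mod_cast hi')

theorem le_localDepth [Nontrivial M] [Module.Finite R M] (h : DepthAtLeast R n M) :
    (n : ℕ∞) ≤ localDepth R M := by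
  obtain ⟨rs, rfl, hmem, hrs⟩ := iff_exists_isRegular.mp h
  exact le_iSup (fun rs : {rs : List R // (∀ r ∈ rs, r ∈ maximalIdeal R) ∧ IsRegular M rs} =>
    (rs.1.length : ℕ∞)) ⟨rs, hmem, hrs⟩

end DepthAtLeast

theorem localDepth_le_supportDim {R : Type*} [CommRing R] [IsLocalRing R] [IsNoetherianRing R]
    {M : Type*} [AddCommGroup M] [Module R M] [Nontrivial M] [Module.Finite R M] :
    (localDepth R M : WithBot ℕ∞) ≤ Module.supportDim R M := by
  have hne := Module.supportDim_ne_bot_of_nontrivial R M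
  rw [← WithBot.coe_unbot _ hne, WithBot.coe_le_coe]
  refine iSup_le fun ⟨rs, hmem, hrs⟩ => ?_
  have h := Module.supportDim_add_length_eq_supportDim_of_isRegular rs hrs
  have := Submodule.Quotient.nontrivial_iff.mpr hrs.top_ne_smul.symm
  have h0 : (0 : WithBot ℕ∞) ≤
      Module.supportDim R (M ⧸ Ideal.ofList rs • (⊤ : Submodule R M)) := by
    rw [← WithBot.coe_unbot _ (Module.supportDim_ne_bot_of_nontrivial R
      (M ⧸ Ideal.ofList rs • (⊤ : Submodule R M)))]
    exact WithBot.coe_le_coe.mpr zero_le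
  change (rs.length : ℕ∞) ≤ _
  rw [← WithBot.coe_le_coe, WithBot.coe_unbot, ← h]
  exact le_add_of_nonneg_left h0

end Depth

/-! ### Primes annihilating an element, and regular sequences -/

section AssociatedPrimes

open RingTheory.Sequence IsLocalRing
open scoped Pointwise

variable {R : Type*} [CommRing R] [IsLocalRing R] [IsNoetherianRing R]

/-- If `M` has a regular sequence of length `r` in the maximal ideal, then every ideal `J` killing a
nonzero element of `M` is contained in a prime `q` with `dim R/q ≥ r`. Applied to the associated
primes of `M`, this gives `depth M ≤ dim R/p`. Here `dim R/q` is the coheight of `q` in the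
spectrum. -/
theorem exists_le_prime_le_coheight (rs : List R) {M : Type*} [AddCommGroup M] [Module R M]
    [Module.Finite R M] (hmem : ∀ r ∈ rs, r ∈ maximalIdeal R) (hrs : IsWeaklyRegular M rs)
    (J : Ideal R) (y : M) (hy : y ≠ 0) (hJ : ∀ a ∈ J, a • y = 0) :
    ∃ q : PrimeSpectrum R, J ≤ q.asIdeal ∧ (rs.length : ℕ∞) ≤ Order.coheight q := by
  induction rs generalizing M J with
  | nil =>
    have hJ1 : J ≠ ⊤ := fun h => hy (by simpa using hJ 1 (h ▸ Submodule.mem_top))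
    exact ⟨⟨maximalIdeal R, inferInstance⟩, le_maximalIdeal hJ1, by simp⟩
  | cons x rs ih =>
    obtain ⟨hx, hrs⟩ := (isWeaklyRegular_cons_iff M x rs).mp hrs
    obtain ⟨hxm, hmem⟩ := List.forall_mem_cons.mp hmem
    obtain ⟨p, hp, hle⟩ := exists_le_isAssociatedPrime_of_isNoetherianRing R y hy
    obtain ⟨hprime, z, hpz⟩ := isAssociatedPrime_iff.mp hp
    have hpz' : ∀ a, a ∈ p ↔ a • z = 0 := fun a => by
      rw [hpz, Submodule.mem_colon_singleton, Submodule.mem_bot]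
    have hz : z ≠ 0 := fun h => hprime.ne_top ((Ideal.eq_top_iff_one p).mpr (by simp [hpz', h]))
    have hxp : x ∉ p := fun h =>
      hz (hx.right_eq_zero_of_smul ((hpz' x).mp h))
    have hJp : J ≤ p := fun a ha => hle (by
      rw [Submodule.mem_colon_singleton, Submodule.mem_bot]; exact hJ a ha)
    -- The elements killed by `p` do not all lie in `x M`: otherwise regularity of `x` would give
    -- `N = x N`, hence `N = 0`. So `M / x M` has a nonzero element killed by `p + (x)`.
    let N : Submodule R M := Submodule.torsionBySet R M p
    have hN : ¬ N ≤ x • (⊤ : Submodule R M) := by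
      intro hle
      have hNx : N ≤ Ideal.span {x} • N := by
        intro w hw
        obtain ⟨w', -, rfl⟩ := (Submodule.mem_smul_pointwise_iff_exists _ _ _).mp (hle hw)
        refine Submodule.smul_mem_smul (Ideal.mem_span_singleton_self x) ?_
        rw [Submodule.mem_torsionBySet_iff] at hw ⊢
        intro a
        refine hx.right_eq_zero_of_smul ?_
        rw [smul_comm]
        exact hw a
      have hbot := Submodule.eq_bot_of_le_smul_of_le_jacobson_bot _ N
        (IsNoetherian.noetherian N) hNx (by
          rw [Ideal.span_singleton_le_iff_mem]
          exact maximalIdeal_le_jacobson _ hxm)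
      refine hz ((Submodule.mem_bot R).mp (hbot ▸ ?_))
      rw [Submodule.mem_torsionBySet_iff]
      exact fun a => (hpz' a).mp a.2
    obtain ⟨w, hw, hwx⟩ := SetLike.not_le_iff_exists.mp hN
    rw [Submodule.mem_torsionBySet_iff] at hw
    obtain ⟨q, hq, hlen⟩ := ih hmem hrs (p ⊔ Ideal.span {x})
      ((x • (⊤ : Submodule R M)).mkQ w) (by simpa using hwx) (by
        intro a ha
        obtain ⟨b, hb, c, hc, rfl⟩ := Submodule.mem_sup.mp ha
        obtain ⟨c, rfl⟩ := Ideal.mem_span_singleton'.mp hc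
        rw [← map_smul, Submodule.mkQ_apply, Submodule.Quotient.mk_eq_zero, add_smul,
          hw ⟨b, hb⟩, zero_add, mul_comm, mul_smul]
        exact Submodule.smul_mem_pointwise_smul _ _ _ trivial)
    have hlt : (⟨p, hprime⟩ : PrimeSpectrum R) < q := by
      refine lt_of_le_of_ne (le_sup_left.trans hq) ?_
      rintro rfl
      exact hxp (hq (Ideal.mem_sup_right (Ideal.mem_span_singleton_self x)))
    refine ⟨⟨p, hprime⟩, hJp, ?_⟩
    rw [List.length_cons, Nat.cast_add, Nat.cast_one]
    exact (add_le_add_left hlen 1).trans (Order.coheight_add_one_le hlt)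

omit [IsLocalRing R] [IsNoetherianRing R] in
theorem coheight_le_supportDim {M : Type*} [AddCommGroup M] [Module R M]
    {q : PrimeSpectrum R} (hq : q ∈ Module.support R M) :
    (Order.coheight q : WithBot ℕ∞) ≤ Module.supportDim R M := by
  rw [Order.coheight_eq_krullDim_Ici]
  exact Order.krullDim_le_of_strictMono
    (fun r : Set.Ici q => (⟨r.1, Module.mem_support_mono r.2 hq⟩ : Module.support R M))
    (fun _ _ h => h)

/-- Over a local ring of dimension `d` with a regular sequence of length `d`, an ideal with nonzero
annihilator lies in an associated prime `q = Ann z` of `R` that is minimal and has `dim R/q ≥ d`. -/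
theorem exists_minimal_associatedPrime {d : ℕ} (hd : ringKrullDim R = d)
    {rs : List R} (hmem : ∀ r ∈ rs, r ∈ maximalIdeal R) (hrs : IsWeaklyRegular R rs)
    (hlen : rs.length = d) {I : Ideal R} (hI : Module.annihilator R I ≠ ⊥) :
    ∃ q : PrimeSpectrum R, I ≤ q.asIdeal ∧ (d : ℕ∞) ≤ Order.coheight q ∧
      q.asIdeal ∈ minimalPrimes R ∧
      ∃ z ∈ Module.annihilator R I, ∀ s, s * z = 0 → s ∈ q.asIdeal := by
  obtain ⟨y, hy, hy0⟩ := Submodule.exists_mem_ne_zero_of_ne_bot hI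
  obtain ⟨p, hp, hle⟩ := exists_le_isAssociatedPrime_of_isNoetherianRing R y hy0
  obtain ⟨hprime, z, hpz⟩ := isAssociatedPrime_iff.mp hp
  have hpz' : ∀ a, a ∈ p ↔ a * z = 0 := fun a => by
    rw [hpz, Submodule.mem_colon_singleton, Submodule.mem_bot, smul_eq_mul]
  have hz : z ≠ 0 := fun h => hprime.ne_top ((Ideal.eq_top_iff_one p).mpr (by simp [hpz', h]))
  have hIp : I ≤ p := fun a ha => hle (by
    rw [Submodule.mem_colon_singleton, Submodule.mem_bot, smul_eq_mul, mul_comm]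
    exact congrArg Subtype.val (Module.mem_annihilator.mp hy ⟨a, ha⟩))
  have hzI : z ∈ Module.annihilator R I := Module.mem_annihilator.mpr fun a =>
    Subtype.ext (by
      change z * (a : R) = 0
      rw [mul_comm]
      exact (hpz' _).mp (hIp a.2))
  obtain ⟨q, hq, hqd⟩ := exists_le_prime_le_coheight rs hmem hrs p z hz
    fun a ha => (hpz' a).mp ha
  rw [hlen] at hqd
  -- A prime strictly below `q` would have coheight at least `d + 1 > dim R`.
  have hmin : ∀ r : PrimeSpectrum R, r ≤ q → r = q := by
    intro r hr
    by_contra hne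
    have h1 := (add_le_add_left hqd 1).trans (Order.coheight_add_one_le (lt_of_le_of_ne hr hne))
    have h2 : (Order.coheight r : WithBot ℕ∞) ≤ d := (Order.coheight_le_krullDim r).trans hd.le
    have h3 : ((d : ℕ∞) + 1) ≤ d := h1.trans (by exact_mod_cast h2)
    exact absurd (show d + 1 ≤ d by exact_mod_cast h3) (by omega)
  obtain rfl : (⟨p, hprime⟩ : PrimeSpectrum R) = q := hmin _ hq
  refine ⟨⟨p, hprime⟩, hIp, hqd, ⟨⟨hprime, bot_le⟩, ?_⟩, z, hzI, fun s => (hpz' s).mpr⟩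
  intro r hr hrp
  exact (congrArg PrimeSpectrum.asIdeal (hmin ⟨r, hr.1⟩ hrp)).ge

end AssociatedPrimes

/-! ### The filtration of the Koszul complex by coordinates -/

section Koszul

variable {R : Type*} [CommRing R] {n : ℕ}

theorem koszulDiff_single_ι_mul (j k : Fin n) (w : ExteriorAlgebra R (Fin n → R)) :
    koszulDiff (Pi.single j 1) (ExteriorAlgebra.ι R (Pi.single k 1) * w) =
      (if j = k then 1 else 0 : R) • w -
        ExteriorAlgebra.ι R (Pi.single k 1) * koszulDiff (Pi.single j 1) w := by
  rw [koszulDiff_ι_mul]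
  congr 2
  simp [Pi.single_apply]

theorem koszulDiff_ι_single_mul (x : Fin n → R) (k : Fin n) (w : ExteriorAlgebra R (Fin n → R)) :
    koszulDiff x (ExteriorAlgebra.ι R (Pi.single k 1) * w) =
      x k • w - ExteriorAlgebra.ι R (Pi.single k 1) * koszulDiff x w := by
  rw [koszulDiff_ι_mul]
  congr 2
  simp [Pi.single_apply]

/-- With `x = e_j` this says that the differential anticommutes with the contraction by the dual
basis vector `e_j^*`. -/
theorem koszulDiff_comm (x y : Fin n → R) (w : ExteriorAlgebra R (Fin n → R)) :
    koszulDiff x (koszulDiff y w) = -koszulDiff y (koszulDiff x w) :=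
  CliffordAlgebra.contractLeft_comm _ _ _

theorem ι_mul_mem_exteriorPower (v : Fin n → R) {i : ℕ} {w : ExteriorAlgebra R (Fin n → R)}
    (hw : w ∈ ⋀[R]^i (Fin n → R)) :
    ExteriorAlgebra.ι R v * w ∈ ⋀[R]^(i + 1) (Fin n → R) := by
  rw [ExteriorAlgebra.exteriorPower, pow_succ']
  exact Submodule.mul_mem_mul ⟨v, rfl⟩ hw

theorem smul_koszulDiff_eq_zero {x : Fin n → R} {r : R} (hr : ∀ j, r * x j = 0)
    (w : ExteriorAlgebra R (Fin n → R)) : r • koszulDiff x w = 0 := by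
  induction w using CliffordAlgebra.left_induction with
  | algebraMap a =>
    rw [koszulDiff_zero_degree x _ (by simp [ExteriorAlgebra.exteriorPower]), smul_zero]
  | add a b ha hb => rw [map_add, smul_add, ha, hb, add_zero]
  | ι_mul a v ha =>
    have h := koszulDiff_ι_mul x v a
    change koszulDiff x (ExteriorAlgebra.ι R v * a) = _ at h
    change r • koszulDiff x (ExteriorAlgebra.ι R v * a) = 0
    rw [h, smul_sub, ← mul_smul_comm, ha, mul_zero, smul_smul, Finset.mul_sum,
      Finset.sum_eq_zero, zero_smul, sub_zero]
    intro j _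
    rw [mul_left_comm, hr, mul_zero]

/-- The exterior algebra on the first `k` of the `n` basis vectors, as a submodule of the exterior
algebra of `Rⁿ`. It is encoded as the common kernel of the contractions with `e_j^*`, `j ≥ k`;
these are Koszul differentials of unit vectors, so all the rules for `koszulDiff` apply to them. -/
noncomputable def exteriorInitial (R : Type*) [CommRing R] (n k : ℕ) :
    Submodule R (ExteriorAlgebra R (Fin n → R)) :=
  ⨅ j : {j : Fin n // k ≤ j}, LinearMap.ker (koszulDiff (Pi.single j.1 1))

theorem mem_exteriorInitial {k : ℕ} {w : ExteriorAlgebra R (Fin n → R)} :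
    w ∈ exteriorInitial R n k ↔ ∀ j : Fin n, k ≤ j → koszulDiff (Pi.single j 1) w = 0 := by
  simp [exteriorInitial]

theorem exteriorInitial_self : exteriorInitial R n n = ⊤ :=
  eq_top_iff.mpr fun _ _ => mem_exteriorInitial.mpr fun j hj => absurd j.2 (by omega)

theorem exteriorInitial_mono : Monotone (exteriorInitial R n) := fun _ _ h _ hw =>
  mem_exteriorInitial.mpr fun j hj => mem_exteriorInitial.mp hw j (h.trans hj)

theorem ι_mul_mem_exteriorInitial (k : Fin n) {w : ExteriorAlgebra R (Fin n → R)}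
    (hw : w ∈ exteriorInitial R n k) :
    ExteriorAlgebra.ι R (Pi.single k 1) * w ∈ exteriorInitial R n (k + 1) :=
  mem_exteriorInitial.mpr fun j hj => by
    rw [koszulDiff_single_ι_mul, mem_exteriorInitial.mp hw j (by omega),
      if_neg (fun h => by subst h; omega), zero_smul, mul_zero, sub_zero]

theorem koszulDiff_single_mem_exteriorInitial (k : Fin n) {w : ExteriorAlgebra R (Fin n → R)}
    (hw : w ∈ exteriorInitial R n (k + 1)) :
    koszulDiff (Pi.single k 1) w ∈ exteriorInitial R n k :=
  mem_exteriorInitial.mpr fun j hj => by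
    rcases hj.eq_or_lt with h | h
    · obtain rfl := Fin.ext h
      exact koszulDiff_koszulDiff _ _
    · rw [koszulDiff_comm, mem_exteriorInitial.mp hw j h, map_zero, neg_zero]

/-- Together with `koszulDiff_single_mem_exteriorInitial` this is the decomposition `w = a + e_k b`
of an element of the exterior algebra on `k + 1` vectors, with `a` and `b` in the one on `k`
vectors. -/
theorem sub_ι_mul_mem_exteriorInitial (k : Fin n) {w : ExteriorAlgebra R (Fin n → R)}
    (hw : w ∈ exteriorInitial R n (k + 1)) :
    w - ExteriorAlgebra.ι R (Pi.single k 1) * koszulDiff (Pi.single k 1) w ∈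
      exteriorInitial R n k :=
  mem_exteriorInitial.mpr fun j hj => by
    rcases hj.eq_or_lt with h | h
    · obtain rfl := Fin.ext h
      rw [map_sub, koszulDiff_single_ι_mul, koszulDiff_koszulDiff, if_pos rfl, one_smul,
        mul_zero, sub_zero, sub_self]
    · refine mem_exteriorInitial.mp (Submodule.sub_mem _ hw ?_) j h
      exact ι_mul_mem_exteriorInitial k (koszulDiff_single_mem_exteriorInitial k hw)

/-- The endomorphism of `Rⁿ` that replaces the `j`-th coordinate by zero. -/
noncomputable def eraseCoord (R : Type*) [CommRing R] {n : ℕ} (j : Fin n) :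
    (Fin n → R) →ₗ[R] (Fin n → R) :=
  LinearMap.id - LinearMap.single R (fun _ : Fin n => R) j ∘ₗ LinearMap.proj j

theorem eraseCoord_apply (j : Fin n) (v : Fin n → R) :
    eraseCoord R j v = v - v j • Pi.single j 1 := by
  ext l
  simp [eraseCoord, Pi.single_apply]

theorem map_eraseCoord (j : Fin n) (w : ExteriorAlgebra R (Fin n → R)) :
    ExteriorAlgebra.map (eraseCoord R j) w =
      w - ExteriorAlgebra.ι R (Pi.single j 1) * koszulDiff (Pi.single j 1) w := by
  induction w using CliffordAlgebra.left_induction with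
  | algebraMap a =>
    rw [koszulDiff_zero_degree _ _ (by simp [ExteriorAlgebra.exteriorPower]), mul_zero, sub_zero]
    exact AlgHom.commutes _ _
  | add a b ha hb => rw [map_add, ha, hb, map_add, mul_add]; abel
  | ι_mul u v hu =>
    change ExteriorAlgebra.map (eraseCoord R j) (ExteriorAlgebra.ι R v * u) =
      ExteriorAlgebra.ι R v * u - ExteriorAlgebra.ι R (Pi.single j 1) *
        koszulDiff (Pi.single j 1) (ExteriorAlgebra.ι R v * u)
    have hsum : ∑ l, v l * (Pi.single j 1 : Fin n → R) l = v j := by simp [Pi.single_apply]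
    have hsq := ExteriorAlgebra.ι_sq_zero (R := R) (Pi.single j 1 : Fin n → R)
    have hswap := ExteriorAlgebra.ι_add_mul_swap (R := R) v (Pi.single j 1 : Fin n → R)
    rw [map_mul, ExteriorAlgebra.map_apply_ι, eraseCoord_apply, hu, koszulDiff_ι_mul, hsum, map_sub,
      map_smul,
      sub_mul, mul_sub, mul_sub, mul_sub, smul_mul_assoc, smul_mul_assoc, ← mul_assoc,
      ← mul_assoc, ← mul_assoc, hsq, zero_mul, smul_zero, sub_zero, mul_smul_comm,
      eq_neg_of_add_eq_zero_left hswap, neg_mul]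
    abel

/-- An element of positive degree killed by all contractions with `e_j^*` is zero: by
`map_eraseCoord` it is fixed by the maps erasing one coordinate, hence by the map induced by `0`. -/
theorem eq_zero_of_mem_exteriorInitial_zero {i : ℕ} {w : ExteriorAlgebra R (Fin n → R)}
    (hw : w ∈ ⋀[R]^(i + 1) (Fin n → R)) (hw' : w ∈ exteriorInitial R n 0) : w = 0 := by
  have key : ∀ k ≤ n, ∃ f : (Fin n → R) →ₗ[R] (Fin n → R),
      (∀ v (l : Fin n), (l : ℕ) < k → f v l = 0) ∧ ExteriorAlgebra.map f w = w := by
    intro k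
    induction k with
    | zero => exact fun _ => ⟨LinearMap.id, fun _ _ h => absurd h (by omega), by
        rw [ExteriorAlgebra.map_id]; rfl⟩
    | succ k ih =>
      intro hk
      obtain ⟨f, hf, hfw⟩ := ih (by omega)
      refine ⟨eraseCoord R ⟨k, hk⟩ ∘ₗ f, fun v l hl => ?_, ?_⟩
      · by_cases h : l = ⟨k, hk⟩
        · subst h; simp [eraseCoord_apply]
        · have : (l : ℕ) < k := lt_of_le_of_ne (by omega) fun h' => h (Fin.ext h')
          simp [eraseCoord_apply, hf v l this, h]
      · rw [← ExteriorAlgebra.map_comp_map, AlgHom.comp_apply, hfw, map_eraseCoord,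
          mem_exteriorInitial.mp hw' _ (Nat.zero_le _), mul_zero, sub_zero]
  obtain ⟨f, hf, hfw⟩ := key n le_rfl
  have hf0 : f = 0 := LinearMap.ext fun v => funext fun l => hf v l l.2
  rw [← hfw, hf0]
  have hle : ⋀[R]^(i + 1) (Fin n → R) ≤ LinearMap.ker
      (ExteriorAlgebra.map (0 : (Fin n → R) →ₗ[R] (Fin n → R))).toLinearMap := by
    rw [← ExteriorAlgebra.ιMulti_span_fixedDegree, Submodule.span_le]
    rintro _ ⟨v, rfl⟩
    rw [SetLike.mem_coe, LinearMap.mem_ker, AlgHom.toLinearMap_apply,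
      ExteriorAlgebra.map_apply_ιMulti]
    exact AlternatingMap.map_coord_zero _ 0 rfl
  exact hle hw

/-- The Koszul homology in degree `i` of the first `k` elements of the sequence `x` vanishes at `p`:
every cycle becomes a boundary after multiplication with an element outside `p`. -/
def KoszulLocallyExact (x : Fin n → R) (p : Ideal R) (k i : ℕ) : Prop :=
  ∀ z ∈ ⋀[R]^i (Fin n → R), z ∈ exteriorInitial R n k → koszulDiff x z = 0 →
    ∃ s ∉ p, ∃ w ∈ ⋀[R]^(i + 1) (Fin n → R), w ∈ exteriorInitial R n k ∧
      koszulDiff x w = s • z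

theorem exists_mul_pow_eq_zero_of_mem_minimalPrimes {p : Ideal R} (hp : p ∈ minimalPrimes R)
    {a : R} (ha : a ∈ p) : ∃ t ∉ p, ∃ N : ℕ, t * a ^ N = 0 := by
  have := hp.1.1
  have h := IsLocalization.AtPrime.radical_map_of_mem_minimalPrimes (Localization.AtPrime p) p ⊥ hp
  have hmem := Ideal.mem_map_of_mem (algebraMap R (Localization.AtPrime p)) ha
  rw [← h, Ideal.map_bot] at hmem
  obtain ⟨N, hN⟩ := hmem
  rw [Ideal.mem_bot, ← map_pow, IsLocalization.map_eq_zero_iff p.primeCompl] at hN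
  obtain ⟨t, ht⟩ := hN
  exact ⟨t, t.2, N, ht⟩

/-- If the Koszul homology of `x_0, …, x_k` in degree `i` vanishes at a minimal prime `p`
containing `x_k`, so does that of `x_0, …, x_{k-1}`. A cycle `z` of the smaller complex satisfies
`z = d a + x_k b` locally, with `b` another cycle; iterating replaces `x_k` by its powers, and
`x_k` is nilpotent in `R_p`. -/
theorem KoszulLocallyExact.of_succ {x : Fin n → R} {p : Ideal R} (hp : p ∈ minimalPrimes R)
    (k : Fin n) (hk : x k ∈ p) {i : ℕ} (h : KoszulLocallyExact x p (k + 1) i) :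
    KoszulLocallyExact x p k i := by
  have hprime := hp.1.1
  have step : ∀ m : ℕ, ∀ z ∈ ⋀[R]^i (Fin n → R), z ∈ exteriorInitial R n k →
      koszulDiff x z = 0 → ∃ s ∉ p, ∃ a ∈ ⋀[R]^(i + 1) (Fin n → R),
        a ∈ exteriorInitial R n k ∧ ∃ b ∈ ⋀[R]^i (Fin n → R), b ∈ exteriorInitial R n k ∧
        koszulDiff x b = 0 ∧ s • z = koszulDiff x a + x k ^ m • b := by
    intro m
    induction m with
    | zero =>
      intro z hz hzk hz0
      exact ⟨1, hprime.one_notMem, 0, zero_mem _, zero_mem _, z, hz, hzk, hz0, by simp⟩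
    | succ m ih =>
      intro z hz hzk hz0
      obtain ⟨s, hs, a, ha, hak, b, hb, hbk, hb0, hab⟩ := ih z hz hzk hz0
      obtain ⟨s', hs', w, hw, hwk, hwb⟩ := h b hb (exteriorInitial_mono (Nat.le_succ _) hbk) hb0
      -- Write `w = a' + e_k c`. As `d w` has no component along `e_k`, `c` is a cycle, and
      -- `d w = d a' + x_k c`.
      have hc := koszulDiff_mem (Pi.single k 1) i w hw
      have hck := koszulDiff_single_mem_exteriorInitial k hwk
      have hc0 : koszulDiff x (koszulDiff (Pi.single k 1) w) = 0 := by
        rw [koszulDiff_comm, hwb, map_smul, mem_exteriorInitial.mp hbk k le_rfl, smul_zero,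
          neg_zero]
      have hek := sub_ι_mul_mem_exteriorInitial k hwk
      have he := Submodule.sub_mem _ hw (ι_mul_mem_exteriorPower (Pi.single k 1) hc)
      generalize koszulDiff (Pi.single k 1) w = c at hc hck hc0 hek he
      have hdw : koszulDiff x (w - ExteriorAlgebra.ι R (Pi.single k 1) * c) =
          s' • b - x k • c := by
        rw [map_sub, hwb, koszulDiff_ι_single_mul, hc0, mul_zero, sub_zero]
      refine ⟨s' * s, hprime.mul_notMem hs' hs,
        s' • a + x k ^ m • (w - ExteriorAlgebra.ι R (Pi.single k 1) * c),
        add_mem (Submodule.smul_mem _ _ ha) (Submodule.smul_mem _ _ he),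
        add_mem (Submodule.smul_mem _ _ hak) (Submodule.smul_mem _ _ hek), c, hc, hck, hc0, ?_⟩
      rw [mul_smul, hab, map_add, map_smul, map_smul, hdw]
      module
  intro z hz hzk hz0
  obtain ⟨t, ht, N, htN⟩ := exists_mul_pow_eq_zero_of_mem_minimalPrimes hp hk
  obtain ⟨s, hs, a, ha, hak, b, -, -, -, hab⟩ := step N z hz hzk hz0
  refine ⟨t * s, hprime.mul_notMem ht hs, t • a, Submodule.smul_mem _ _ ha,
    Submodule.smul_mem _ _ hak, ?_⟩
  rw [mul_smul, hab, smul_add, smul_smul, htN, zero_smul, add_zero, map_smul]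

/-- Rigidity of the Koszul complex at a minimal prime containing the sequence: vanishing in degree
`i` implies vanishing in degree `i + 1`. -/
theorem KoszulLocallyExact.succ_degree {x : Fin n → R} {p : Ideal R} (hp : p ∈ minimalPrimes R)
    (hx : ∀ j, x j ∈ p) {k : ℕ} (hk : k ≤ n) {i : ℕ} (h : KoszulLocallyExact x p k i) :
    KoszulLocallyExact x p k (i + 1) := by
  have hprime := hp.1.1
  induction k with
  | zero =>
    intro z hz hzk _
    exact ⟨1, hprime.one_notMem, 0, zero_mem _, zero_mem _, by
      rw [eq_zero_of_mem_exteriorInitial_zero hz hzk, map_zero, smul_zero]⟩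
  | succ k ih =>
    have h' := KoszulLocallyExact.of_succ hp ⟨k, hk⟩ (hx _) h
    have ih' := ih (by omega) h'
    intro z hz hzk hz0
    -- Write `z = a + e_k b`. Locally `b = d c`, and then the cycle `a + x_k c` is a boundary `d f`, so
    -- that `z = d (f - e_k c)`.
    have hb := koszulDiff_mem (Pi.single ⟨k, hk⟩ 1) i z hz
    have hbk := koszulDiff_single_mem_exteriorInitial ⟨k, hk⟩ hzk
    have hb0 : koszulDiff x (koszulDiff (Pi.single ⟨k, hk⟩ 1) z) = 0 := by
      rw [koszulDiff_comm, hz0, map_zero, neg_zero]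
    have hak := sub_ι_mul_mem_exteriorInitial ⟨k, hk⟩ hzk
    have ha := Submodule.sub_mem _ hz (ι_mul_mem_exteriorPower (Pi.single ⟨k, hk⟩ 1) hb)
    generalize koszulDiff (Pi.single ⟨k, hk⟩ 1) z = b at hb hbk hb0 hak ha
    have hda : koszulDiff x (z - ExteriorAlgebra.ι R (Pi.single ⟨k, hk⟩ 1) * b) =
        -(x ⟨k, hk⟩ • b) := by
      rw [map_sub, hz0, koszulDiff_ι_single_mul, hb0, mul_zero, sub_zero, zero_sub]
    obtain ⟨s, hs, c, hc, hck, hcb⟩ := h' b hb hbk hb0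
    obtain ⟨s', hs', f, hf, hfk, hfa⟩ := ih'
      (s • (z - ExteriorAlgebra.ι R (Pi.single ⟨k, hk⟩ 1) * b) + x ⟨k, hk⟩ • c)
      (add_mem (Submodule.smul_mem _ _ ha) (Submodule.smul_mem _ _ hc))
      (add_mem (Submodule.smul_mem _ _ hak) (Submodule.smul_mem _ _ hck)) (by
        rw [map_add, map_smul, map_smul, hda, hcb]; module)
    have hc' := Submodule.smul_mem _ s' hc
    have hck' := Submodule.smul_mem _ s' hck
    have hg := Submodule.sub_mem _ hf (ι_mul_mem_exteriorPower (Pi.single ⟨k, hk⟩ 1) hc')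
    have hgk := Submodule.sub_mem _ (exteriorInitial_mono (Nat.le_succ _) hfk)
      (ι_mul_mem_exteriorInitial ⟨k, hk⟩ hck')
    refine ⟨s' * s, hprime.mul_notMem hs' hs, _, hg, hgk, ?_⟩
    rw [map_sub, hfa, koszulDiff_ι_single_mul, map_smul, hcb, mul_smul_comm, mul_smul_comm]
    module

end Koszul

/-! ### The top exterior power -/

section Top

variable {R : Type*} [CommRing R] {n : ℕ}

theorem eq_zero_of_mem_exteriorPower_succ {w : ExteriorAlgebra R (Fin n → R)}
    (hw : w ∈ ⋀[R]^(n + 1) (Fin n → R)) : w = 0 := by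
  let b := (Pi.basisFun R (Fin n)).exteriorPower (n + 1)
  have : IsEmpty (Set.powersetCard (Fin n) (n + 1)) := ⟨fun s => by
    have h1 : s.1.card = n + 1 := s.2
    have h2 := s.1.card_le_univ
    rw [Fintype.card_fin] at h2
    omega⟩
  have h : (⟨w, hw⟩ : ⋀[R]^(n + 1) (Fin n → R)) = 0 :=
    b.repr.injective (Subsingleton.elim _ _)
  exact congrArg Subtype.val h

/-- The top exterior power is free of rank one. -/
theorem exists_exteriorPower_generator (R : Type*) [CommRing R] (n : ℕ) :
    ∃ ω ∈ ⋀[R]^n (Fin n → R), (∀ r : R, r • ω = 0 → r = 0) ∧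
      ∀ w ∈ ⋀[R]^n (Fin n → R), ∃ r : R, w = r • ω := by
  let b := (Pi.basisFun R (Fin n)).exteriorPower n
  let t : Set.powersetCard (Fin n) n := ⟨Finset.univ, by simp [Set.powersetCard]⟩
  have ht : ∀ s, s = t := fun s => Subtype.ext (Finset.card_eq_iff_eq_univ s.1 |>.mp (by
    have h : s.1.card = n := s.2
    rw [h, Fintype.card_fin]))
  have hrep : ∀ w, w = b.repr w t • b t := fun w => b.repr.injective (by
    ext s
    simp [ht s])
  refine ⟨b t, (b t).2, fun r hr => ?_, fun w hw => ⟨b.repr ⟨w, hw⟩ t, ?_⟩⟩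
  · have h : r • b t = 0 := Subtype.ext hr
    simpa using congrArg (fun w => b.repr w t) h
  · exact congrArg Subtype.val (hrep ⟨w, hw⟩)

/-- The cycles of top degree are the multiples `r ω` with `r` in the annihilator of the ideal. -/
theorem smul_koszulDiff_generator_eq_zero_iff {x : Fin n → R} {ω : ExteriorAlgebra R (Fin n → R)}
    (hω : ω ∈ ⋀[R]^n (Fin n → R)) (hω0 : ∀ r : R, r • ω = 0 → r = 0) {r : R} :
    koszulDiff x (r • ω) = 0 ↔ r ∈ Module.annihilator R (Ideal.span (Set.range x)) := by
  have hann : r ∈ Module.annihilator R (Ideal.span (Set.range x)) ↔ ∀ j, r * x j = 0 := by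
    rw [Ideal.span, Submodule.mem_annihilator_span]
    simp
  rw [hann, map_smul]
  refine ⟨fun h j => hω0 _ ?_, fun h => smul_koszulDiff_eq_zero h ω⟩
  have h0 := koszulDiff_ι_single_mul x j ω
  rw [eq_zero_of_mem_exteriorPower_succ (ι_mul_mem_exteriorPower _ hω), map_zero] at h0
  rw [mul_smul, sub_eq_zero.mp h0.symm, ← mul_smul_comm, h, mul_zero]

/-- The boundaries in degree `n - 1` are the image of `⋀ⁿ Rⁿ ≅ R`, that is, `R / Ann I`. -/
theorem nonempty_quotient_annihilator_equiv_koszulBoundaries {m : ℕ} (x : Fin (m + 1) → R) :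
    Nonempty ((R ⧸ Module.annihilator R (Ideal.span (Set.range x))) ≃ₗ[R]
      koszulBoundaries x m) := by
  obtain ⟨ω, hω, hω0, hω1⟩ := exists_exteriorPower_generator R (m + 1)
  let f : R →ₗ[R] koszulBoundaries x m :=
    LinearMap.codRestrict _ (koszulDiff x ∘ₗ LinearMap.toSpanSingleton R _ ω)
      fun r => ⟨r • ω, Submodule.smul_mem _ r hω, rfl⟩
  have hf : Function.Surjective f := by
    rintro ⟨_, w, hw, rfl⟩
    obtain ⟨r, rfl⟩ := hω1 w hw
    exact ⟨r, rfl⟩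
  have hker : LinearMap.ker f = Module.annihilator R (Ideal.span (Set.range x)) := by
    ext r
    rw [← smul_koszulDiff_generator_eq_zero_iff hω hω0, LinearMap.mem_ker, Subtype.ext_iff]
    rfl
  exact ⟨(Submodule.quotEquivOfEq _ _ hker.symm).trans (f.quotKerEquivOfSurjective hf)⟩

/-- At a minimal associated prime `p = Ann z` containing the sequence, all Koszul homology in
degrees `0, …, n` is nonzero: by rigidity its vanishing would make `z ω` zero in `R_p`, where `ω`
generates `⋀ⁿ Rⁿ`. -/
theorem mem_support_koszulHomology {x : Fin n → R} {p : PrimeSpectrum R}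
    (hp : p.asIdeal ∈ minimalPrimes R) (hx : ∀ j, x j ∈ p.asIdeal) {z : R}
    (hz : z ∈ Module.annihilator R (Ideal.span (Set.range x)))
    (hzp : ∀ s, s * z = 0 → s ∈ p.asIdeal) {i : ℕ} (hi : i ≤ n) :
    p ∈ Module.support R (KoszulHomology x i) := by
  by_contra hnot
  rw [Module.notMem_support_iff'] at hnot
  have h : KoszulLocallyExact x p.asIdeal n i := by
    intro w hw _ hw0
    obtain ⟨s, hs, hsw⟩ := hnot (Submodule.Quotient.mk ⟨w, hw, hw0⟩)
    rw [← Submodule.Quotient.mk_smul, Submodule.Quotient.mk_eq_zero] at hsw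
    obtain ⟨u, hu, huw⟩ := hsw
    exact ⟨s, hs, u, hu, exteriorInitial_self (R := R) ▸ Submodule.mem_top, huw⟩
  have htop : ∀ j, i ≤ j → KoszulLocallyExact x p.asIdeal n j := fun j hj =>
    Nat.le_induction h (fun _ _ ih => ih.succ_degree hp hx le_rfl) j hj
  obtain ⟨ω, hω, hω0, -⟩ := exists_exteriorPower_generator R n
  obtain ⟨s, hs, w, hw, -, hws⟩ := htop n hi (z • ω) (Submodule.smul_mem _ z hω)
    (exteriorInitial_self (R := R) ▸ Submodule.mem_top)
    ((smul_koszulDiff_generator_eq_zero_iff hω hω0).mpr hz)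
  rw [eq_zero_of_mem_exteriorPower_succ hw, map_zero, smul_smul] at hws
  exact hs (hzp s (hω0 _ hws.symm))

end Top

/-! ### Depth of the boundaries and Cohen–Macaulayness -/

section Main

variable {R : Type u} [CommRing R] [IsLocalRing R] {n d : ℕ}

/-- The depth bound passes up the Koszul complex along the exact sequences `0 → B_i → Z_i → H_i → 0`
and `0 → Z_{i+1} → ⋀^{i+1} Rⁿ → B_i → 0`, starting from `Z_0 = ⋀^0 Rⁿ`. -/
theorem depthAtLeast_koszulBoundaries (hR : DepthAtLeast R d R) (x : Fin n → R) (l : ℕ)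
    (hH : ∀ i ≤ l, DepthAtLeast R d (KoszulHomology x i)) :
    DepthAtLeast R d (koszulBoundaries x l) := by
  have hB : ∀ i ≤ l, DepthAtLeast R d (koszulCycles x i) →
      DepthAtLeast R d (koszulBoundaries x i) := fun i hi hZ =>
    DepthAtLeast.left_of_exact
      (f := Submodule.inclusion (koszulBoundaries_le_koszulCycles x i))
      (g := ((koszulBoundaries x i).submoduleOf (koszulCycles x i)).mkQ)
      (fun w => by
        rw [Submodule.mkQ_apply, Submodule.Quotient.mk_eq_zero]
        exact ⟨fun hw => ⟨⟨w.1, hw⟩, rfl⟩, by rintro ⟨v, rfl⟩; exact v.2⟩)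
      (Submodule.inclusion_injective _) (Submodule.mkQ_surjective _) hZ (hH i hi)
  have hZ : ∀ i ≤ l, DepthAtLeast R d (koszulCycles x i) := by
    intro i
    induction i with
    | zero =>
      intro _
      have h : koszulCycles x 0 = ⋀[R]^0 (Fin n → R) :=
        inf_eq_left.mpr fun w hw => koszulDiff_zero_degree x w hw
      rw [h]
      exact DepthAtLeast.of_free hR
    | succ i ih =>
      intro hi
      refine DepthAtLeast.left_of_exact (M₂ := ⋀[R]^(i + 1) (Fin n → R))
        (M₃ := koszulBoundaries x i)
        (f := Submodule.inclusion inf_le_left)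
        (g := (koszulDiff x).restrict fun w hw => ⟨w, hw, rfl⟩)
        (fun w => ⟨fun hw => ⟨⟨w.1, w.2, congrArg Subtype.val hw⟩, rfl⟩, ?_⟩)
        (Submodule.inclusion_injective _) ?_ (DepthAtLeast.of_free hR)
        (hB i (by omega) (ih (by omega)))
      · rintro ⟨v, rfl⟩
        exact Subtype.ext v.2.2
      · rintro ⟨_, w, hw, rfl⟩
        exact ⟨⟨w, hw⟩, rfl⟩
  exact hB l le_rfl (hZ l le_rfl)

variable [IsNoetherianRing R]

/-- The zero module is allowed, whence the form of the hypothesis on the dimension. -/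
theorem IsCMModule.depthAtLeast {M : Type u} [AddCommGroup M] [Module R M]
    (hM : IsCMModule R M) (hd : Nontrivial M → (d : WithBot ℕ∞) ≤ Module.supportDim R M) :
    DepthAtLeast R d M := by
  have := hM.1
  rcases subsingleton_or_nontrivial M with h | h
  · exact DepthAtLeast.of_subsingleton
  · have heq := hM.2.resolve_left (not_subsingleton M)
    refine DepthAtLeast.of_le_localDepth ?_
    have h' := hd h
    rw [← heq] at h'
    exact_mod_cast h'

/-- Conversely a nonzero module of depth at least `dim R` is maximal Cohen–Macaulay, because
`depth M ≤ dim M ≤ dim R`. -/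
theorem DepthAtLeast.isMaximalCMModule {M : Type u} [AddCommGroup M] [Module R M]
    [Nontrivial M] [Module.Finite R M] (hd : ringKrullDim R = d) (hM : DepthAtLeast R d M) :
    IsMaximalCMModule R M := by
  have h1 : (d : WithBot ℕ∞) ≤ localDepth R M := by exact_mod_cast hM.le_localDepth
  have h2 : (localDepth R M : WithBot ℕ∞) ≤ Module.supportDim R M := localDepth_le_supportDim
  have h3 : Module.supportDim R M ≤ d := hd ▸ Module.supportDim_le_ringKrullDim R M
  exact ⟨⟨inferInstance, Or.inr (le_antisymm h2 (h3.trans h1))⟩,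
    (le_antisymm h3 (h1.trans h2)).trans hd.symm⟩

end Main

theorem theorem2p6 {R : Type*} [CommRing R] [IsLocalRing R] [IsNoetherianRing R]
    (hR : IsCMModule R R) (I : Ideal R) (hI : I ≠ ⊥) (hSCM : IsStronglyCMIdeal I) :
    IsMaximalCMModule R (R ⧸ Module.annihilator R I) := by
  obtain ⟨d, hd⟩ : ∃ d : ℕ, ringKrullDim R = d := by
    obtain ⟨e, he⟩ := WithBot.ne_bot_iff_exists.mp (ringKrullDim_ne_bot (R := R))
    have hne : e ≠ ⊤ := fun h => ringKrullDim_ne_top (R := R) (by rw [← he, h]; rfl)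
    obtain ⟨d, rfl⟩ := ENat.ne_top_iff_exists.mp hne
    exact ⟨d, he.symm⟩
  have hdepth : DepthAtLeast R d R :=
    hR.depthAtLeast fun _ => by rw [Module.supportDim_self_eq_ringKrullDim, hd]
  have hne : Module.annihilator R I ≠ ⊤ := fun h => hI <|
    (Submodule.subsingleton_iff_eq_bot).mp (Module.annihilator_eq_top_iff.mp h)
  have : Nontrivial (R ⧸ Module.annihilator R I) := Ideal.Quotient.nontrivial_iff.mpr hne
  refine DepthAtLeast.isMaximalCMModule hd ?_
  by_cases hann : Module.annihilator R I = ⊥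
  · exact DepthAtLeast.of_linearEquiv (Submodule.quotEquivOfEqBot _ hann).symm hdepth
  obtain ⟨n, x, rfl, hH⟩ := hSCM
  obtain ⟨rs, hlen, hmem, hrs⟩ := DepthAtLeast.iff_exists_isRegular.mp hdepth
  obtain ⟨q, hIq, hqd, hqmin, z, hz, hzq⟩ :=
    exists_minimal_associatedPrime hd hmem hrs.toIsWeaklyRegular hlen hann
  obtain _ | m := n
  -- The empty sequence generates the zero ideal.
  · exact absurd (by simp) hI
  obtain ⟨e⟩ := nonempty_quotient_annihilator_equiv_koszulBoundaries x
  refine DepthAtLeast.of_linearEquiv e.symm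
    (depthAtLeast_koszulBoundaries hdepth x m fun i hi => ?_)
  refine (hH i).depthAtLeast fun _ => ?_
  have hsupp := mem_support_koszulHomology hqmin
    (fun j => hIq (Ideal.subset_span (Set.mem_range_self j))) hz hzq (Nat.le_succ_of_le hi)
  refine le_trans ?_ (coheight_le_supportDim hsupp)
  exact_mod_cast hqd
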